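/- Let $d\ge 2$ and let $\mathsf A\subset\mathbb Z^d$ be a finite set with at least two elements. Let $\Pi_{\mathsf A}$ be the set of all permutations $\pi$ of $\mathbb Z^d$ with $\pi(\mathbf n)-\mathbf n\in\mathsf A$ for every $\mathbf n\in\mathbb Z^d$, and let $$\Omega_{\mathsf A}=\bigl\{(\pi(\mathbf n)-\mathbf n)_{\mathbf n\in\mathbb Z^d}:\pi\in\Pi_{\mathsf A}\bigr\}\subset\mathsf A^{\mathbb Z^d}$$ be the associated $\mathbb Z^d$-shift of finite type. Call $\Omega_{\mathsf A}$ topologically mixing if for any two nonempty finite sets $V,V'\subset\mathbb Z^d$ there is an $N\in\mathbb N$ such that for all $\omega,\omega'\in\Omega_{\mathsf A}$ and every $\mathbf n\in\mathbb Z^d$ with $\|\mathbf n\|\ge N$ (where $\|\cdot\|$ is the maximum norm) there is an $\omega''\in\Omega_{\mathsf A}$ which agrees with $\omega$ on $V$ and with $\omega'$ on $V'+\mathbf n$. Then $\Omega_{\mathsf A}$ is topologically mixing if and only if $\mathsf A-\mathsf A=\{\mathbf a-\mathbf b:\mathbf a,\mathbf b\in\mathsf A\}$ is not contained in a one-dimensional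 linear subspace of $\mathbb R^d$. -/

import Mathlib

open scoped Pointwise

/-- The set `Π_A` of all permutations `π` of `ℤ^d` such that `π n - n ∈ A` for every `n`. -/
def restrictedPerms {d : ℕ} (A : Finset (Fin d → ℤ)) : Set (Equiv.Perm (Fin d → ℤ)) :=
  {π | ∀ n, π n - n ∈ A}

/-- The point `ω^(π) = (π n - n)_n` of `A^(ℤ^d)` determined by a permutation `π ∈ Π_A`. -/
def displacement {d : ℕ} (A : Finset (Fin d → ℤ)) (π : restrictedPerms A) :
    (Fin d → ℤ) → A :=
  fun n => ⟨π.1 n - n, π.2 n⟩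

/-- The `ℤ^d`-shift space `Ω_A = {ω^(π) : π ∈ Π_A} ⊆ A^(ℤ^d)`. -/
def Omega {d : ℕ} (A : Finset (Fin d → ℤ)) : Set ((Fin d → ℤ) → A) :=
  Set.range (displacement A)

/-- Topological mixing of a `ℤ^d`-shift space `Ω ⊆ S^(ℤ^d)`: for all nonempty finite
`V, V' ⊆ ℤ^d` there is an `N` such that for all `ω, ω' ∈ Ω` and every `n` with `‖n‖ ≥ N`
(maximum norm) some `ω'' ∈ Ω` agrees with `ω` on `V` and with `ω'` on `V' + n`. -/
def IsTopologicallyMixing {d : ℕ} {S : Type*} (Ω : Set ((Fin d → ℤ) → S)) : Prop :=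
  ∀ V V' : Finset (Fin d → ℤ), V.Nonempty → V'.Nonempty →
    ∃ N : ℕ, ∀ ω ∈ Ω, ∀ ω' ∈ Ω, ∀ n : Fin d → ℤ, (N : ℝ) ≤ ‖n‖ →
      ∃ ω'' ∈ Ω, (∀ m ∈ V, ω'' m = ω m) ∧ (∀ m ∈ V', ω'' (m + n) = ω' (m + n))

/-- The inclusion `ℤ^d ⊆ ℝ^d`. -/
def latticeToReal {d : ℕ} (v : Fin d → ℤ) : Fin d → ℝ :=
  fun i => (v i : ℝ)

/-! If `A` has three non-collinear points, the partial bijection given by `π` on one patch and `π'`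
on a far one is extended by Hall's theorem. A large set `S` expands enough under `+ A` to absorb the
finitely many forbidden targets. A small `S` misses some annulus around the origin; `π` on the part
inside and `π'` on the part outside match `S` injectively (`card_le_card_add_sdiff_of_far_apart`).
The same bound for `-A` gives the reverse injection, and Schröder–Bernstein a permutation. If `A`
lies on a line, each coset of the corresponding discrete subgroup is like `ℤ`, and a
bounded-displacement permutation has the same flux through every point of it. The constant
configurations `a` and `b` have different fluxes, so they cannot be glued
(`no_perm_with_changing_flux`). -/

/-! ### Hall's theorem and extension of partial bijections -/

open Finset in
/-- A bijection between finite sets extends to a permutation with displacements in `A` as soon as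
Hall's condition holds for the complements, in both directions. -/
theorem exists_restrictedPerm_extending {d : ℕ} {A U T : Finset (Fin d → ℤ)}
    {p : (Fin d → ℤ) → (Fin d → ℤ)} (hp : Set.BijOn p U T) (hpA : ∀ x ∈ U, p x - x ∈ A)
    (hUT : ∀ S : Finset (Fin d → ℤ), Disjoint S U → #S ≤ #((S + A) \ T))
    (hTU : ∀ S : Finset (Fin d → ℤ), Disjoint S T → #S ≤ #((S + -A) \ U)) :
    ∃ π ∈ restrictedPerms A, ∀ x ∈ U, π x = p x := by
  have hall : ∀ {B Y Z : Finset (Fin d → ℤ)},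
      (∀ S : Finset (Fin d → ℤ), Disjoint S Y → #S ≤ #((S + B) \ Z)) →
      ∃ f : {x // x ∉ Y} → {y // y ∉ Z}, Function.Injective f ∧ ∀ x, (f x : Fin d → ℤ) - x ∈ B := by
    intro B Y Z h
    obtain ⟨f, hf, hfm⟩ := (Finset.all_card_le_biUnion_card_iff_exists_injective
      (fun x : {x // x ∉ Y} => ({x.1} + B) \ Z)).1 (fun s => by
        have h1 := h (s.map (Function.Embedding.subtype _)) (by
          rw [Finset.disjoint_left]
          intro x hx
          obtain ⟨y, -, rfl⟩ := Finset.mem_map.1 hx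
          exact y.2)
        rw [Finset.card_map] at h1
        refine h1.trans (Finset.card_le_card fun y hy => ?_)
        obtain ⟨hy1, hy2⟩ := Finset.mem_sdiff.1 hy
        obtain ⟨z, hz, b, hb, rfl⟩ := Finset.mem_add.1 hy1
        obtain ⟨w, hw, rfl⟩ := Finset.mem_map.1 hz
        exact Finset.mem_biUnion.2 ⟨w, hw, Finset.mem_sdiff.2
          ⟨Finset.add_mem_add (Finset.mem_singleton_self _) hb, hy2⟩⟩)
    refine ⟨fun x => ⟨f x, (Finset.mem_sdiff.1 (hfm x)).2⟩,
      fun x y hxy => hf (congrArg Subtype.val hxy), fun x => ?_⟩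
    obtain ⟨y, hy, b, hb, h2⟩ := Finset.mem_add.1 (Finset.mem_sdiff.1 (hfm x)).1
    rw [Finset.mem_singleton.1 hy] at h2
    simpa [← h2] using hb
  obtain ⟨f, hf, hfA⟩ := hall hUT
  obtain ⟨g, hg, hgA⟩ := hall hTU
  -- The bijection follows `f` or the inverse of `g` at each point, so displacements stay in `A`.
  obtain ⟨h, hh, hhA⟩ := Function.Embedding.schroeder_bernstein_of_rel hf hg
    (fun x y => (y : Fin d → ℤ) - x ∈ A) hfA (fun y => by simpa using hgA y)
  let e : {x // x ∈ U} ≃ {y // y ∈ T} := Set.BijOn.equiv p hp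
  have heU : ∀ x (hx : x ∈ U), Equiv.subtypeCongr e (Equiv.ofBijective h hh) x = p x := by
    intro x hx
    simp only [Equiv.subtypeCongr, Equiv.trans_apply, Equiv.sumCompl_symm_apply_of_pos hx]
    rfl
  refine ⟨Equiv.subtypeCongr e (Equiv.ofBijective h hh), fun x => ?_, heU⟩
  by_cases hx : x ∈ U
  · rw [heU x hx]
    exact hpA x hx
  · simp only [Equiv.subtypeCongr, Equiv.trans_apply, Equiv.sumCompl_symm_apply_of_neg hx]
    exact hhA ⟨x, hx⟩

/-! ### Expansion of finite sets under addition of `A` -/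

/-- Moving backwards in steps of `u ≠ 0`, one leaves every finite set of lattice points. -/
theorem exists_sub_nsmul_mem_diff {d : ℕ} {u : Fin d → ℤ} (hu : u ≠ 0)
    (S : Finset (Fin d → ℤ)) {s : Fin d → ℤ} (hs : s ∈ S) :
    ∃ k : ℕ, s - k • u ∈ S \ (S + {u}) := by
  classical
  have hex : ∃ k : ℕ, s - k • u ∉ S := by
    by_contra! hall
    refine Set.infinite_of_injective_forall_mem (f := fun k : ℕ => s - k • u) ?_ hall
      S.finite_toSet
    intro k l hkl
    have : k • u = l • u := sub_right_injective hkl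
    obtain ⟨i, hi⟩ := Function.ne_iff.1 hu
    have h := congrFun this i
    simp only [Pi.smul_apply, nsmul_eq_mul] at h
    exact_mod_cast mul_right_cancel₀ hi h
  have hpos : Nat.find hex ≠ 0 := by
    intro h0
    have := Nat.find_spec hex
    rw [h0] at this
    simp [hs] at this
  obtain ⟨k, hk⟩ := Nat.exists_eq_succ_of_ne_zero hpos
  refine ⟨k, Finset.mem_sdiff.2 ⟨not_not.1 (Nat.find_min hex (m := k) (by omega)), fun hmem => ?_⟩⟩
  obtain ⟨y, hy, z, hz, hyz⟩ := Finset.mem_add.1 hmem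
  rw [Finset.mem_singleton.1 hz] at hyz
  have hspec := Nat.find_spec hex
  rw [hk] at hspec
  apply hspec
  have : s - k.succ • u = y := by
    rw [Nat.succ_eq_add_one, add_smul, one_smul, ← sub_sub, ← hyz, add_sub_cancel_right]
  rwa [this]

open Finset in
/-- A finite set of lattice points has at most as many points as pairs of first points on the lines
in two independent directions. -/
theorem card_le_card_diff_mul_card_diff {d : ℕ} {u v : Fin d → ℤ}
    (huv : ∀ i j : ℤ, i • u = j • v → i = 0 ∧ j = 0) (S : Finset (Fin d → ℤ)) :
    #S ≤ #(S \ (S + {u})) * #(S \ (S + {v})) := by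
  have hu : u ≠ 0 := by
    rintro rfl
    simpa using huv 1 0
  have hv : v ≠ 0 := by
    rintro rfl
    simpa using huv 0 1
  choose! k hk using fun s (hs : s ∈ S) => exists_sub_nsmul_mem_diff hu S hs
  choose! l hl using fun s (hs : s ∈ S) => exists_sub_nsmul_mem_diff hv S hs
  rw [← Finset.card_product]
  -- A point is the unique intersection of its `u`-line and its `v`-line, so the two endpoints
  -- determine it.
  refine Finset.card_le_card_of_injOn (fun s => (s - k s • u, s - l s • v))
    (fun s hs => Finset.mem_coe.2 (Finset.mem_product.2 ⟨hk s hs, hl s hs⟩)) ?_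
  intro s _ t _ hst
  obtain ⟨h1, h2⟩ := Prod.mk.inj hst
  have h3 : s - t = ((k s : ℤ) - k t) • u := by
    rw [sub_smul, natCast_zsmul, natCast_zsmul]
    linear_combination (exp := 1) h1
  have h4 : s - t = ((l s : ℤ) - l t) • v := by
    rw [sub_smul, natCast_zsmul, natCast_zsmul]
    linear_combination (exp := 1) h2
  have h5 := (huv _ _ (h3.symm.trans h4)).1
  rw [h5, zero_smul] at h3
  exact sub_eq_zero.1 h3

-- `S + A` contains the union of the translates `S + {a}` and `S + {b}`; the points of the first
-- outside the second come on top of the `#S` points of the second.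
open Finset in
theorem card_add_card_diff_le_card_add {d : ℕ} {A : Finset (Fin d → ℤ)} {a b : Fin d → ℤ}
    (ha : a ∈ A) (hb : b ∈ A) (S : Finset (Fin d → ℤ)) :
    #S + #(S \ (S + {b - a})) ≤ #(S + A) := by
  have hadd : ∀ c : Fin d → ℤ, S + {c} = S.image (· + c) := fun c => Finset.add_singleton c
  have h1 : #(S \ (S + {b - a})) = #((S + {a}) \ (S + {b})) := by
    rw [← Finset.card_image_of_injective (S \ (S + {b - a})) (add_left_injective a),
      Finset.image_sdiff _ _ (add_left_injective a)]
    congr 2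
    · rw [hadd]
    · rw [hadd, hadd, Finset.image_image]
      congr 1
      funext x
      simp only [Function.comp_apply]
      abel
  have h2 : #S = #(S + {b}) := by
    rw [hadd, Finset.card_image_of_injective _ (add_left_injective b)]
  rw [h1, h2, add_comm, Finset.card_sdiff_add_card]
  exact Finset.card_le_card (Finset.union_subset
    (Finset.add_subset_add_left (Finset.singleton_subset_iff.2 ha))
    (Finset.add_subset_add_left (Finset.singleton_subset_iff.2 hb)))

open Finset in
/-- If `A` contains three non-collinear points, then sets of at least `q ^ 2` points grow by at
least `q` points under addition of `A`. -/
theorem card_add_le_card_add_of_sq_le {d : ℕ} {A : Finset (Fin d → ℤ)} {a b c : Fin d → ℤ}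
    (ha : a ∈ A) (hb : b ∈ A) (hc : c ∈ A)
    (hind : ∀ i j : ℤ, i • (b - a) = j • (c - a) → i = 0 ∧ j = 0)
    {S : Finset (Fin d → ℤ)} {q : ℕ} (hS : q ^ 2 ≤ #S) : #S + q ≤ #(S + A) := by
  have h1 := card_add_card_diff_le_card_add ha hb S
  have h2 := card_add_card_diff_le_card_add ha hc S
  have h3 := card_le_card_diff_mul_card_diff hind S
  by_contra! h
  have h4 : #(S \ (S + {b - a})) < q := by omega
  have h5 : #(S \ (S + {c - a})) < q := by omega
  have := Nat.mul_lt_mul'' h4 h5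
  nlinarith

open Finset in
-- Gluing far apart patches
/-- Hall's condition for the complement of two far apart patches, each of which is matched by
an injection with displacements in `A`. -/
theorem card_le_card_add_sdiff_of_far_apart {d : ℕ} {A : Finset (Fin d → ℤ)} {a b c : Fin d → ℤ}
    (ha : a ∈ A) (hb : b ∈ A) (hc : c ∈ A)
    (hind : ∀ i j : ℤ, i • (b - a) = j • (c - a) → i = 0 ∧ j = 0)
    {C R : ℝ} (hC : ∀ x ∈ A, ‖x‖ ≤ C) {π π' : Equiv.Perm (Fin d → ℤ)}
    (hπ : π ∈ restrictedPerms A) (hπ' : π' ∈ restrictedPerms A)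
    {X X' : Finset (Fin d → ℤ)} {n : Fin d → ℤ} (hX : ∀ x ∈ X, ‖x‖ ≤ R)
    (hX' : ∀ x ∈ X', ‖x - n‖ ≤ R) {q : ℕ} (hq : #X + #X' ≤ q)
    (hn : 2 * R + 2 * C + (q ^ 2 + 1) * (2 * C + 1) ≤ ‖n‖)
    {S : Finset (Fin d → ℤ)} (hS : Disjoint S (X ∪ X')) :
    #S ≤ #((S + A) \ (X.image π ∪ X'.image π')) := by
  rcases le_or_gt (q ^ 2) #S with hlarge | hsmall
  · have h1 := card_add_le_card_add_of_sq_le ha hb hc hind hlarge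
    have h2 : #(X.image π ∪ X'.image π') ≤ q :=
      (Finset.card_union_le _ _).trans
        ((add_le_add Finset.card_image_le Finset.card_image_le).trans hq)
    have h3 := Finset.le_card_sdiff (X.image π ∪ X'.image π') (S + A)
    omega
  · have hC0 : 0 ≤ C := (norm_nonneg a).trans (hC a ha)
    have hD : 0 < 2 * C + 1 := by linarith
    -- some annulus of width `2 * C + 1` contains no point of `S`
    obtain ⟨k, hkq, hk⟩ := Finset.exists_mem_notMem_of_card_lt_card
      (s := S.image fun x => ⌊(‖x‖ - R) / (2 * C + 1)⌋)
      (t := (Finset.range (q ^ 2)).image (fun k : ℕ => (k : ℤ))) (by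
        rw [Finset.card_image_of_injective _ Nat.cast_injective, Finset.card_range]
        exact Finset.card_image_le.trans_lt hsmall)
    obtain ⟨k, hkr, rfl⟩ := Finset.mem_image.1 hkq
    have hkq' : (k : ℝ) ≤ q ^ 2 := by exact_mod_cast (Finset.mem_range.1 hkr).le
    set r : ℝ := R + k * (2 * C + 1) with hr
    have hkD : (0 : ℝ) ≤ k * (2 * C + 1) := by positivity
    have hrn : r + 2 * C + R + (2 * C + 1) ≤ ‖n‖ := by nlinarith
    have hgap : ∀ x ∈ S, ¬ ‖x‖ < r → r + (2 * C + 1) ≤ ‖x‖ := by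
      intro x hx hxr
      by_contra! hlt
      refine hk (Finset.mem_image.2 ⟨x, hx, Int.floor_eq_iff.2 ⟨?_, ?_⟩⟩)
      · rw [le_div_iff₀ hD]
        push_cast
        linarith
      · rw [div_lt_iff₀ hD]
        push_cast
        linarith
    have hdist : ∀ {σ : Equiv.Perm (Fin d → ℤ)}, σ ∈ restrictedPerms A → ∀ x, ‖σ x - x‖ ≤ C :=
      fun hσ x => hC _ (hσ x)
    obtain ⟨hSX, hSX'⟩ := Finset.disjoint_union_right.1 hS
    -- Each part moves by at most `C`, and the gap of width `2 * C + 1` exceeds `2 * C`.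
    have hdisj : Disjoint ((S.filter (‖·‖ < r)).image π) ((S.filter (¬ ‖·‖ < r)).image π') := by
      rw [Finset.disjoint_left]
      intro y hy hy'
      obtain ⟨s, hs, rfl⟩ := Finset.mem_image.1 hy
      obtain ⟨t, ht, hst⟩ := Finset.mem_image.1 hy'
      rw [Finset.mem_filter] at hs ht
      have h1 := hgap t ht.1 ht.2
      have h2 := norm_le_norm_add_norm_sub' (π s) s
      have h3 := norm_le_norm_add_norm_sub (π' t) t
      have h4 := hdist hπ s
      have h5 := hdist hπ' t
      rw [hst] at h3 h5
      linarith [hs.2]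
    calc #S = #(S.filter (‖·‖ < r)) + #(S.filter (¬ ‖·‖ < r)) :=
          (Finset.card_filter_add_card_filter_not _).symm
      _ = #((S.filter (‖·‖ < r)).image π ∪ (S.filter (¬ ‖·‖ < r)).image π') := by
          rw [Finset.card_union_of_disjoint hdisj, Finset.card_image_of_injective _ π.injective,
            Finset.card_image_of_injective _ π'.injective]
      _ ≤ _ := by
        -- Each part avoids the image of the patch under its own permutation by injectivity, and the
        -- image of the other patch by distance.
        refine Finset.card_le_card (Finset.union_subset ?_ ?_)
        · intro y hy
          obtain ⟨s, hs, rfl⟩ := Finset.mem_image.1 hy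
          rw [Finset.mem_filter] at hs
          refine Finset.mem_sdiff.2 ⟨Finset.mem_add.2 ⟨s, hs.1, _, hπ s, by abel⟩, fun hmem => ?_⟩
          rcases Finset.mem_union.1 hmem with h | h
          · obtain ⟨x, hx, hxs⟩ := Finset.mem_image.1 h
            rw [π.injective hxs] at hx
            exact Finset.disjoint_left.1 hSX hs.1 hx
          · obtain ⟨x, hx, hxs⟩ := Finset.mem_image.1 h
            have h1 := hdist hπ s
            have h2 := hdist hπ' x
            have h3 := hX' x hx
            rw [hxs] at h2
            have h4 := norm_le_norm_add_norm_sub' (π s) s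
            have h5 := norm_le_norm_add_norm_sub (π s) x
            have h6 := norm_le_norm_add_norm_sub x n
            linarith [hs.2]
        · intro y hy
          obtain ⟨s, hs, rfl⟩ := Finset.mem_image.1 hy
          rw [Finset.mem_filter] at hs
          refine Finset.mem_sdiff.2 ⟨Finset.mem_add.2 ⟨s, hs.1, _, hπ' s, by abel⟩, fun hmem => ?_⟩
          rcases Finset.mem_union.1 hmem with h | h
          · obtain ⟨x, hx, hxs⟩ := Finset.mem_image.1 h
            have h0 := hgap s hs.1 hs.2
            have h1 := hdist hπ' s
            have h2 := hdist hπ x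
            have h3 := hX x hx
            rw [hxs] at h2
            have h4 := norm_le_norm_add_norm_sub (π' s) s
            have h5 := norm_le_norm_add_norm_sub' (π' s) x
            linarith
          · obtain ⟨x, hx, hxs⟩ := Finset.mem_image.1 h
            rw [π'.injective hxs] at hx
            exact Finset.disjoint_left.1 hSX' hs.1 hx

theorem symm_mem_restrictedPerms_neg {d : ℕ} {A : Finset (Fin d → ℤ)}
    {π : Equiv.Perm (Fin d → ℤ)} (hπ : π ∈ restrictedPerms A) : π.symm ∈ restrictedPerms (-A) := by
  intro n
  have := hπ (π.symm n)
  simpa using this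

open Finset in
theorem isTopologicallyMixing_Omega_of_noncollinear {d : ℕ} {A : Finset (Fin d → ℤ)}
    {a b c : Fin d → ℤ} (ha : a ∈ A) (hb : b ∈ A) (hc : c ∈ A)
    (hind : ∀ i j : ℤ, i • (b - a) = j • (c - a) → i = 0 ∧ j = 0) :
    IsTopologicallyMixing (Omega A) := by
  classical
  intro V V' _ _
  have hbound : ∀ B : Finset (Fin d → ℤ), ∃ C : ℝ, ∀ x ∈ B, ‖x‖ ≤ C :=
    fun B => B.finite_toSet.isBounded.exists_norm_le
  obtain ⟨C, hC⟩ := hbound A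
  obtain ⟨R, hR⟩ := hbound (V ∪ V')
  have hC0 : 0 ≤ C := (norm_nonneg a).trans (hC a ha)
  set q : ℕ := #V + #V' with hq
  -- The radius is `R + C` because in the reverse direction the patches are the images under `π` and
  -- `π'`.
  obtain ⟨N, hN⟩ := exists_nat_ge (2 * (R + C) + 2 * C + (q ^ 2 + 1) * (2 * C + 1))
  refine ⟨N, ?_⟩
  rintro _ ⟨⟨π, hπ⟩, rfl⟩ _ ⟨⟨π', hπ'⟩, rfl⟩ n hNn
  have hn := hN.trans hNn
  have hqC : (0 : ℝ) ≤ q ^ 2 * (2 * C + 1) := by positivity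
  set X' : Finset (Fin d → ℤ) := V'.image (· + n) with hX'
  have hV : ∀ x ∈ V, ‖x‖ ≤ R := fun x hx => hR x (Finset.mem_union_left _ hx)
  have hV' : ∀ x ∈ X', ‖x - n‖ ≤ R := by
    intro x hx
    obtain ⟨y, hy, rfl⟩ := Finset.mem_image.1 hx
    simpa using hR y (Finset.mem_union_right _ hy)
  have hcard : #X' = #V' := Finset.card_image_of_injective _ (add_left_injective n)
  have hπV : ∀ x ∈ V.image π, ‖x‖ ≤ R + C := by
    intro x hx
    obtain ⟨y, hy, rfl⟩ := Finset.mem_image.1 hx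
    have h1 := norm_le_norm_add_norm_sub' (π y) y
    linarith [hV y hy, hC _ (hπ y)]
  have hπV' : ∀ x ∈ X'.image π', ‖x - n‖ ≤ R + C := by
    intro x hx
    obtain ⟨y, hy, rfl⟩ := Finset.mem_image.1 hx
    have h1 := norm_sub_le_norm_sub_add_norm_sub (π' y) y n
    linarith [hV' y hy, hC _ (hπ' y)]
  have hfar : ∀ x x', ‖x‖ ≤ R + C → ‖x' - n‖ ≤ R + C → x ≠ x' := by
    rintro x _ h1 h2 rfl
    have h3 := norm_le_norm_add_norm_sub x n
    linarith
  have hVX' : ∀ x ∈ X', x ∉ V := fun x hx hxV =>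
    hfar x x (by linarith [hV x hxV]) (by linarith [hV' x hx]) rfl
  have hbij : Set.BijOn (fun x => if x ∈ V then π x else π' x) ↑(V ∪ X')
      ↑(V.image π ∪ X'.image π') := by
    refine ⟨?_, ?_, ?_⟩
    · intro x hx
      rw [Finset.mem_coe] at hx ⊢
      by_cases hxV : x ∈ V
      · simpa only [hxV, if_true] using
          Finset.mem_union_left _ (Finset.mem_image_of_mem _ hxV)
      · simpa only [hxV, if_false] using Finset.mem_union_right _ (Finset.mem_image_of_mem _
          ((Finset.mem_union.1 hx).resolve_left hxV))
    · intro x hx y hy hxy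
      rw [Finset.mem_coe] at hx hy
      by_cases hxV : x ∈ V <;> by_cases hyV : y ∈ V <;>
        simp only [hxV, hyV, if_true, if_false] at hxy
      · exact π.injective hxy
      · exact absurd hxy (hfar _ _ (hπV _ (Finset.mem_image_of_mem _ hxV)) (hπV' _
          (Finset.mem_image_of_mem _ ((Finset.mem_union.1 hy).resolve_left hyV))))
      · exact absurd hxy.symm (hfar _ _ (hπV _ (Finset.mem_image_of_mem _ hyV)) (hπV' _
          (Finset.mem_image_of_mem _ ((Finset.mem_union.1 hx).resolve_left hxV))))
      · exact π'.injective hxy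
    · intro y hy
      rw [Finset.mem_coe] at hy
      rcases Finset.mem_union.1 hy with h | h
      · obtain ⟨x, hx, rfl⟩ := Finset.mem_image.1 h
        exact ⟨x, Finset.mem_coe.2 (Finset.mem_union_left _ hx), by simp [hx]⟩
      · obtain ⟨x, hx, rfl⟩ := Finset.mem_image.1 h
        exact ⟨x, Finset.mem_coe.2 (Finset.mem_union_right _ hx), by simp [hVX' x hx]⟩
  obtain ⟨ρ, hρ, hρV⟩ := exists_restrictedPerm_extending hbij
    (A := A) (by
      intro x _
      by_cases hxV : x ∈ V
      · simpa only [hxV, if_true] using hπ x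
      · simpa only [hxV, if_false] using hπ' x)
    (fun S hS => card_le_card_add_sdiff_of_far_apart ha hb hc hind hC hπ hπ' hV hV'
      (q := q) (by omega) (by linarith) hS)
    -- The reverse condition is the same bound for `-A` and the inverse permutations.
    (fun S hS => by
      have h := card_le_card_add_sdiff_of_far_apart (A := -A) (a := -a) (b := -b) (c := -c)
        (Finset.neg_mem_neg ha) (Finset.neg_mem_neg hb) (Finset.neg_mem_neg hc)
        (fun i j hij => hind i j (by
          rw [neg_sub_neg, neg_sub_neg, ← neg_sub b, ← neg_sub c, smul_neg, smul_neg] at hij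
          exact neg_injective hij))
        (C := C) (fun x hx => by simpa using hC (-x) (by simpa using hx))
        (symm_mem_restrictedPerms_neg hπ) (symm_mem_restrictedPerms_neg hπ') hπV hπV'
        (q := q) (by
          rw [Finset.card_image_of_injective _ π.injective,
            Finset.card_image_of_injective _ π'.injective]
          omega) (by linarith) hS
      simpa [Finset.image_image] using h)
  refine ⟨_, ⟨⟨ρ, hρ⟩, rfl⟩, fun m hm => Subtype.ext ?_, fun m hm => Subtype.ext ?_⟩
  · change ρ m - m = π m - m
    rw [hρV m (Finset.mem_union_left _ hm), if_pos hm]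
  · have hmX : m + n ∈ X' := Finset.mem_image_of_mem _ hm
    change ρ (m + n) - (m + n) = π' (m + n) - (m + n)
    rw [hρV _ (Finset.mem_union_right _ hmX), if_neg (hVX' _ hmX)]

/-! ### Flux obstruction in the collinear case -/

/-- On a subgroup `L` on which the `i`-th coordinate is injective, a permutation moving points of
`L` by bounded elements of `L` cannot fix a neighbourhood of `0` and translate a neighbourhood of
a far away point: the flux along `L` would not be constant. -/
theorem no_perm_with_changing_flux {d : ℕ} {L : AddSubgroup (Fin d → ℤ)} {i : Fin d}
    (hL : ∀ x ∈ L, x i = 0 → x = 0) {σ : Equiv.Perm (Fin d → ℤ)} {C : ℤ}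
    (hσL : ∀ x, σ x - x ∈ L) (hσC : ∀ x, |(σ x - x) i| ≤ C)
    {u n : Fin d → ℤ} (hu : u ∈ L) (hui : 0 < u i) (huC : u i ≤ C) (hn : n ∈ L) (hni : u i ≤ n i)
    (hfix : ∀ x ∈ L, |x i| ≤ C → σ x = x)
    (htrans : ∀ x ∈ L, |x i| ≤ C → σ (x + n) = x + n + u) : False := by
  have hinj : ∀ x ∈ L, ∀ y ∈ L, x i = y i → x = y := fun x hx y hy hxy =>
    sub_eq_zero.1 (hL _ (L.sub_mem hx hy) (by simp [hxy]))
  set B : Set (Fin d → ℤ) := {x | x ∈ L ∧ 0 ≤ x i ∧ x i < n i} with hB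
  have hBfin : B.Finite := Set.Finite.of_injOn (f := fun x => x i) (t := Set.Ico 0 (n i))
    (fun x hx => ⟨hx.2.1, hx.2.2⟩) (fun x hx y hy hxy => hinj x hx.1 y hy.1 hxy)
    (Set.finite_Ico _ _)
  -- No point enters the segment `B`: near `0` points are fixed, near `n` they move upwards, and
  -- others are too far away.
  have hmaps : Set.MapsTo σ.symm B B := by
    intro y hy
    obtain ⟨x, rfl⟩ := σ.surjective y
    rw [Equiv.symm_apply_apply]
    have hxL : x ∈ L := by
      have := L.sub_mem hy.1 (hσL x)
      simpa using this
    have h1 := abs_le.1 (hσC x)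
    rw [Pi.sub_apply] at h1
    refine ⟨hxL, ?_, ?_⟩
    · by_contra! hx
      by_cases hxC : -C ≤ x i
      · have := hfix x hxL (abs_le.2 ⟨hxC, by omega⟩)
        have := hy.2.1
        simp_all
        omega
      · have := hy.2.1
        omega
    · by_contra! hx
      by_cases hxC : x i - n i ≤ C
      · have h2 := htrans (x - n) (L.sub_mem hxL hn) (abs_le.2
          ⟨by rw [Pi.sub_apply]; omega, by rw [Pi.sub_apply]; omega⟩)
        rw [sub_add_cancel] at h2
        have h3 := hy.2.2
        rw [h2, Pi.add_apply] at h3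
        omega
      · have := hy.2.2
        omega
  have hsurj : Set.SurjOn σ.symm B B := by
    refine ((hBfin.injOn_iff_bijOn_of_mapsTo hmaps).1 σ.symm.injective.injOn).surjOn
  -- By finiteness `σ.symm` is onto `B`, yet `σ` carries `n - u` to `n`, outside `B`.
  obtain ⟨y, hy, hyu⟩ := hsurj (show n - u ∈ B from
    ⟨L.sub_mem hn hu, by rw [Pi.sub_apply]; omega, by rw [Pi.sub_apply]; omega⟩)
  have h1 := htrans (-u) (L.neg_mem hu) (by rw [Pi.neg_apply, abs_neg, abs_of_pos hui]; exact huC)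
  rw [neg_add_eq_sub, ← hyu, Equiv.apply_symm_apply, hyu, sub_add_cancel] at h1
  have := hy.2.2
  rw [h1] at this
  exact lt_irrefl _ this

theorem not_isTopologicallyMixing_Omega_of_collinear {d : ℕ} {A : Finset (Fin d → ℤ)}
    {L : AddSubgroup (Fin d → ℤ)} {i : Fin d} (hL : ∀ x ∈ L, x i = 0 → x = 0)
    (hAL : ∀ a ∈ A, ∀ b ∈ A, b - a ∈ L) {a b : Fin d → ℤ} (ha : a ∈ A) (hb : b ∈ A)
    (hab : a i < b i) : ¬ IsTopologicallyMixing (Omega A) := by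
  intro hmix
  obtain ⟨C, hC⟩ : ∃ C : ℤ, ∀ x ∈ A, |(x - a) i| ≤ C :=
    ⟨A.sup' ⟨a, ha⟩ fun x => |(x - a) i|, fun x hx => Finset.le_sup' (fun x => |(x - a) i|) hx⟩
  have hC0 : 0 ≤ C := (abs_nonneg _).trans (hC a ha)
  have hinj : ∀ x ∈ L, ∀ y ∈ L, x i = y i → x = y := fun x hx y hy hxy =>
    sub_eq_zero.1 (hL _ (L.sub_mem hx hy) (by simp [hxy]))
  have hfin : {x | x ∈ L ∧ |x i| ≤ C}.Finite :=
    Set.Finite.of_injOn (f := fun x => x i) (t := Set.Icc (-C) C)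
      (fun x hx => abs_le.1 hx.2) (fun x hx y hy hxy => hinj x hx.1 y hy.1 hxy)
      (Set.finite_Icc _ _)
  have hne : hfin.toFinset.Nonempty := ⟨0, by simpa using hC0⟩
  obtain ⟨N, hN⟩ := hmix hfin.toFinset hfin.toFinset hne hne
  have hconst : ∀ c (hc : c ∈ A), (fun _ => (⟨c, hc⟩ : A)) ∈ Omega A := by
    intro c hc
    refine ⟨⟨Equiv.addRight c, fun n => by simpa using hc⟩, ?_⟩
    funext n
    exact Subtype.ext (by simp [displacement])
  have hui : 0 < (b - a) i := sub_pos.2 hab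
  -- The factor `N + 1` rather than `N` also ensures `u i ≤ n i` when `N = 0`.
  have hni : ((N : ℤ) + 1) ≤ (((N : ℤ) + 1) • (b - a)) i := by
    rw [Pi.smul_apply, smul_eq_mul]
    nlinarith
  obtain ⟨_, ⟨⟨π, hπ⟩, rfl⟩, h1, h2⟩ := hN _ (hconst a ha) _ (hconst b hb)
    (((N : ℤ) + 1) • (b - a)) (by
      refine le_trans ?_ (norm_le_pi_norm _ i)
      rw [Int.norm_eq_abs]
      refine le_trans ?_ (le_abs_self _)
      exact_mod_cast (by omega : (N : ℤ) ≤ (((N : ℤ) + 1) • (b - a)) i))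
  -- Subtracting `a` turns the glued permutation into the identity near `0` and translation by `b -
  -- a` near `n`.
  refine no_perm_with_changing_flux hL (σ := π.trans (Equiv.subRight a)) (C := C)
    (u := b - a) (n := ((N : ℤ) + 1) • (b - a)) ?_ ?_ (hAL a ha b hb) hui ?_
    (L.zsmul_mem (hAL a ha b hb) _) ?_ ?_ ?_
  · intro x
    have := hAL a ha _ (hπ x)
    simpa [sub_right_comm] using this
  · intro x
    have := hC _ (hπ x)
    simpa [sub_right_comm] using this
  · exact (le_abs_self _).trans (hC b hb)
  · rw [Pi.smul_apply, smul_eq_mul]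
    nlinarith
  · intro x hx hxC
    have h3 : π x - x = a := congrArg Subtype.val (h1 x (by simpa using ⟨hx, hxC⟩))
    simp [← h3]
  · intro x hx hxC
    have h3 := congrArg Subtype.val (h2 x (by simpa using ⟨hx, hxC⟩))
    change π _ - _ = b at h3
    rw [Equiv.trans_apply, Equiv.subRight_apply, sub_eq_iff_eq_add.1 h3]
    abel

/-! ### Passage to real subspaces and conclusion -/

theorem latticeToReal_zsmul {d : ℕ} (k : ℤ) (v : Fin d → ℤ) :
    latticeToReal (k • v) = (k : ℝ) • latticeToReal v := by
  funext i
  simp [latticeToReal]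

theorem latticeToReal_sub {d : ℕ} (v w : Fin d → ℤ) :
    latticeToReal (v - w) = latticeToReal v - latticeToReal w := by
  funext i
  simp [latticeToReal]

theorem latticeToReal_injective {d : ℕ} : Function.Injective (@latticeToReal d) := by
  intro v w h
  funext i
  exact Int.cast_injective (congrFun h i)

theorem theorem5p6 (d : ℕ) (hd : 2 ≤ d) (A : Finset (Fin d → ℤ)) (hA : 2 ≤ A.card) :
    IsTopologicallyMixing (Omega A) ↔
      ¬ ∃ W : Submodule ℝ (Fin d → ℝ), Module.finrank ℝ W = 1 ∧
        latticeToReal '' ((A : Set (Fin d → ℤ)) - (A : Set (Fin d → ℤ))) ⊆ (W : Set (Fin d → ℝ)) := by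
  obtain ⟨a, ha, b, hb, hab⟩ := Finset.one_lt_card.1 hA
  have hzero : latticeToReal (0 : Fin d → ℤ) = 0 := by
    funext i
    simp [latticeToReal]
  have hne : latticeToReal (b - a) ≠ 0 := by
    rw [← hzero]
    exact fun h => hab (sub_eq_zero.1 (latticeToReal_injective h)).symm
  constructor
  · rintro hmix ⟨W, hW, hAW⟩
    have hmem : ∀ x ∈ A, ∀ y ∈ A, latticeToReal (y - x) ∈ W := fun x hx y hy =>
      hAW ⟨y - x, Set.sub_mem_sub hy hx, rfl⟩
    obtain ⟨i, hi⟩ := Function.ne_iff.1 hab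
    let L : AddSubgroup (Fin d → ℤ) :=
      { carrier := {x | latticeToReal x ∈ W}
        zero_mem' := by
          rw [Set.mem_ofPred_eq, hzero]
          exact W.zero_mem
        add_mem' := by
          intro x y hx hy
          have h : latticeToReal (x + y) = latticeToReal x + latticeToReal y := by
            funext j
            simp [latticeToReal]
          rw [Set.mem_ofPred_eq, h]
          exact W.add_mem hx hy
        neg_mem' := by
          intro x hx
          have h : latticeToReal (-x) = -latticeToReal x := by
            funext j
            simp [latticeToReal]
          rw [Set.mem_ofPred_eq, h]
          exact W.neg_mem hx }
    -- `W` is spanned by `b - a`, whose `i`-th coordinate is nonzero.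
    have hL : ∀ x ∈ L, x i = 0 → x = 0 := by
      intro x hx hxi
      obtain ⟨t, ht⟩ := (finrank_eq_one_iff_of_nonzero' (⟨_, hmem a ha b hb⟩ : W)
        (fun h => hne (congrArg Subtype.val h))).1 hW ⟨_, hx⟩
      have ht' : t • latticeToReal (b - a) = latticeToReal x := congrArg Subtype.val ht
      have hti := congrFun ht' i
      have hbi : ((b - a) i : ℝ) ≠ 0 := by
        exact_mod_cast sub_ne_zero.2 (Ne.symm hi)
      have ht0 : t = 0 := by
        simp only [Pi.smul_apply, smul_eq_mul, latticeToReal, hxi, Int.cast_zero] at hti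
        exact (mul_eq_zero.1 hti).resolve_right hbi
      rw [ht0, zero_smul, ← hzero] at ht'
      exact (latticeToReal_injective ht').symm
    rcases lt_or_gt_of_ne hi with h | h
    · exact not_isTopologicallyMixing_Omega_of_collinear hL hmem ha hb h hmix
    · exact not_isTopologicallyMixing_Omega_of_collinear hL hmem hb ha h hmix
  · intro hW
    obtain ⟨c, hc, hcW⟩ : ∃ c ∈ A, latticeToReal (c - a) ∉
        Submodule.span ℝ {latticeToReal (b - a)} := by
      by_contra! hall
      refine hW ⟨_, finrank_span_singleton hne, ?_⟩
      rintro _ ⟨_, ⟨x, hx, y, hy, rfl⟩, rfl⟩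
      have h := Submodule.sub_mem _ (hall x hx) (hall y hy)
      rwa [← latticeToReal_sub, sub_sub_sub_cancel_right] at h
    refine isTopologicallyMixing_Omega_of_noncollinear ha hb hc fun i j hij => ?_
    have hij' : (i : ℝ) • latticeToReal (b - a) = (j : ℝ) • latticeToReal (c - a) := by
      rw [← latticeToReal_zsmul, ← latticeToReal_zsmul, hij]
    have hj : j = 0 := by
      by_contra hj
      have hj' : (j : ℝ) ≠ 0 := by exact_mod_cast hj
      refine hcW (Submodule.mem_span_singleton.2 ⟨(j : ℝ)⁻¹ * i, ?_⟩)
      rw [mul_smul, hij', inv_smul_smul₀ hj']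
    refine ⟨?_, hj⟩
    rw [hj, Int.cast_zero, zero_smul] at hij'
    exact_mod_cast (smul_eq_zero.1 hij').resolve_right hne
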